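/- Let $\mathbb{F}_3((X^{-1}))$ be the field of formal Laurent series in $X^{-1}$ over $\mathbb{F}_3$. For a nonzero series $F=\sum_{h\ge -m} f_h X^{-h}$ with $f_{-m}\neq 0$ put $|F|=2^m$, put $|0|=0$, and let $\|F\|$ be the absolute value of the fractional part $\sum_{h\ge 1} f_hX^{-h}$ of $F$. A pair $(\Theta,\Phi)$ of elements of $\mathbb{F}_3((X^{-1}))$ satisfies the Littlewood conjecture if $$\inf_{q\in\mathbb{F}_3[X]\setminus\{0\}} |q|\cdot\|q\Theta\|\cdot\|q\Phi\| = 0,$$ and it does so non-trivially if moreover $\Theta$ and $\Phi$ are both badly approximable, that is, $\inf_{q\ne 0}|q|\cdot\|q\Theta\|>0$ and $\inf_{q\neq 0}|q|\cdot\|q\Phi\|>0$, and $1,\Theta,\Phi$ are linearly independent over $\mathbb{F}_3[X]$. For every integer $n\ge 1$ let $H_n$ be the finite word $$H_n = X^{[3^n-2]},\; X+\varepsilon,\; 2X+\varepsilon,\; (2X)^{[3^n-2]},\; 2X+\varepsilon,\; X+\varepsilon$$ over $\mathbb{F}_3[X]$, where $W^{[\ell]}$ denotes the word $W$ repeated $\ell$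 times, and $\varepsilon=2$ if $n$ is odd, $\varepsilon=1$ if $n$ is even. **Theorem 5.** The polynomial $$X(X+2)Z^4-(X^3+2X^2+2X+2)Z^3+Z-X-1$$ has exactly one root $\Theta$ in $\mathbb{F}_3((X^{-1}))$. The continued fraction expansion of $\Theta$ is $$\Theta=[X,\,2X+2,\,X+1,\,H_1,\,H_2,\,H_3,\ldots].$$ Both $\Theta$ and $\Theta^{-1}$ are quartic (algebraic of degree $4$ over $\mathbb{F}_3(X)$), and the pair $(\Theta,\Theta^{-1})$ satisfies the Littlewood conjecture non-trivially. In particular, there exists a pair of quartic power series in $\mathbb{F}_3((X^{-1}))$ satisfying non-trivially the Littlewood conjecture. -/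

import Mathlib

open Polynomial

noncomputable section

namespace PowerSeriesLittlewood

/-- The field `k((X⁻¹))`. It is the field of formal Laurent series in the variable `T = X⁻¹`:
the series `∑ₕ fₕ X⁻ʰ` (with `fₕ = 0` for `h` small) has coefficient `fₕ` at `h`. -/
abbrev InvLaurent (k : Type*) [Field k] : Type _ := LaurentSeries k

variable {k : Type*} [Field k]

/-- The indeterminate `X`, seen as an element of `k((X⁻¹))`. -/
def indet (k : Type*) [Field k] : InvLaurent k := HahnSeries.single (-1 : ℤ) (1 : k)

/-- The embedding `k[X] → k((X⁻¹))`. -/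
def ofPoly : k[X] →ₐ[k] InvLaurent k := Polynomial.aeval (indet k)

/-- The absolute value on `k((X⁻¹))`: `|0| = 0`, and `|F| = 2 ^ m` if the leading term of `F`
is a nonzero multiple of `X ^ m`. (`F.order` is the least `h` with nonzero coefficient of
`X⁻ʰ`.) -/
def absv (F : InvLaurent k) : ℝ :=
  open Classical in if F = 0 then 0 else (2 : ℝ) ^ (-F.order)

/-- The polynomial part of a series: the terms `fₕ X⁻ʰ` with `h ≤ 0`. -/
def polyPart (F : InvLaurent k) : InvLaurent k := HahnSeries.truncLTLinearMap k (1 : ℤ) F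

/-- The fractional part of a series: the terms `fₕ X⁻ʰ` with `h > 0`. -/
def fracPart (F : InvLaurent k) : InvLaurent k := F - polyPart F

theorem coeff_fracPart (F : InvLaurent k) (h : ℤ) :
    (fracPart F).coeff h = if 0 < h then F.coeff h else 0 := by
  unfold fracPart polyPart
  rw [HahnSeries.coeff_sub, HahnSeries.coe_truncLTLinearMap]
  split_ifs with hh
  · rw [HahnSeries.coeff_truncLT_of_le (by omega)]; simp
  · rw [HahnSeries.coeff_truncLT_of_lt (by omega)]; simp

/-- `‖F‖`, the absolute value of the fractional part of `F`. -/
def fracAbsv (F : InvLaurent k) : ℝ := absv (fracPart F)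

/-- The set of badly approximable series. -/
def Bad (k : Type*) [Field k] : Set (InvLaurent k) :=
  {Θ | 0 < ⨅ q : {q : k[X] // q ≠ 0}, absv (ofPoly q.1) * fracAbsv (ofPoly q.1 * Θ)}

/-- The pair `(Θ, Φ)` satisfies the Littlewood conjecture. -/
def Littlewood (Θ Φ : InvLaurent k) : Prop :=
  (⨅ q : {q : k[X] // q ≠ 0},
    absv (ofPoly q.1) * fracAbsv (ofPoly q.1 * Θ) * fracAbsv (ofPoly q.1 * Φ)) = 0

/-- `1, Θ, Φ` are linearly independent over `k[X]`. -/
def LinIndepWithOne (Θ Φ : InvLaurent k) : Prop :=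
  ∀ a b c : k[X], ofPoly a + ofPoly b * Θ + ofPoly c * Φ = 0 → a = 0 ∧ b = 0 ∧ c = 0

/-- The pair `(Θ, Φ)` satisfies the Littlewood conjecture non-trivially. -/
def LittlewoodNontrivially (Θ Φ : InvLaurent k) : Prop :=
  Littlewood Θ Φ ∧ Θ ∈ Bad k ∧ Φ ∈ Bad k ∧ LinIndepWithOne Θ Φ

/-- The subfield `k(X)` of `k((X⁻¹))`. -/
def ratField (k : Type*) [Field k] : IntermediateField k (InvLaurent k) :=
  IntermediateField.adjoin k {indet k}

/-- `Θ` is quartic: algebraic over `k(X)` of degree exactly `4`. -/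
def IsQuartic (Θ : InvLaurent k) : Prop :=
  IsIntegral (ratField k) Θ ∧ (minpoly (ratField k) Θ).natDegree = 4

/-- The complete quotients of `F` in the continued fraction algorithm:
`F₀ = F` and `Fₙ₊₁ = 1 / (Fₙ - aₙ)`, where `aₙ` is the polynomial part of `Fₙ`. -/
def completeQuotient (F : InvLaurent k) : ℕ → InvLaurent k
  | 0 => F
  | n + 1 => (fracPart (completeQuotient F n))⁻¹

/-- The continued fraction expansion of `F` is the infinite expansion `[a₀, a₁, a₂, …]`: the
algorithm never stops, and its partial quotients are the polynomials `aₙ`. -/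
def HasContFrac (F : InvLaurent k) (a : ℕ → k[X]) : Prop :=
  ∀ n, fracPart (completeQuotient F n) ≠ 0 ∧ polyPart (completeQuotient F n) = ofPoly (a n)

/-- `ε = 2` if `n` is odd, and `ε = 1` otherwise. -/
def eps (n : ℕ) : (ZMod 3)[X] := if Odd n then 2 else 1

/-- The word `Hₙ` (for `n ≥ 1`). -/
def wordH (n : ℕ) : List (ZMod 3)[X] :=
  List.replicate (3 ^ n - 2) X ++ [X + eps n, 2 * X + eps n] ++
    List.replicate (3 ^ n - 2) (2 * X) ++ [2 * X + eps n, X + eps n]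

/-- The finite word `X, 2X+2, X+1, H₁, H₂, …, H_N`. -/
def wordPrefix : ℕ → List (ZMod 3)[X]
  | 0 => [X, 2 * X + 2, X + 1]
  | N + 1 => wordPrefix N ++ wordH (N + 1)

theorem length_wordPrefix (N : ℕ) : (wordPrefix N).length = 3 ^ (N + 1) := by
  induction N with
  | zero => rfl
  | succ N ih =>
    have : 2 ≤ 3 ^ (N + 1) := by
      have := Nat.one_le_pow N 3 (by norm_num)
      rw [pow_succ]; omega
    simp only [wordPrefix, wordH, List.length_append, List.length_replicate, List.length_cons,
      List.length_nil, ih]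
    rw [pow_succ 3 (N + 1)]
    omega

theorem lt_length_wordPrefix (n : ℕ) : n < (wordPrefix n).length := by
  rw [length_wordPrefix]
  exact (Nat.lt_succ_self n).trans (Nat.lt_pow_self (by norm_num))

/-- The infinite word `X, 2X+2, X+1, H₁, H₂, H₃, …`. Its letter at index `n` (counted from `0`)
is read off the prefix ending with `Hₙ`, which has more than `n` letters. -/
def millsRobbins (n : ℕ) : (ZMod 3)[X] := (wordPrefix n)[n]'(lt_length_wordPrefix n)

/-- The value at `Z` of `X(X+2)Z⁴ - (X³+2X²+2X+2)Z³ + Z - X - 1`, in `F₃((X⁻¹))`. -/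
def quarticEval (Z : InvLaurent (ZMod 3)) : InvLaurent (ZMod 3) :=
  ofPoly (X * (X + 2)) * Z ^ 4 - ofPoly (X ^ 3 + 2 * X ^ 2 + 2 * X + 2) * Z ^ 3 + Z
    - ofPoly X - 1

end PowerSeriesLittlewood

end

open Polynomial

noncomputable section

namespace PowerSeriesLittlewood

variable {k : Type*} [Field k]

/-! ### The absolute value -/

/-! The quartic says that `Θ` is the image of its own cube under a homography over `F₃[X]` of
determinant `-(X² + 1)`. Since cubing is the Frobenius, it acts letter by letter on continued
fractions, so knowing a prefix of the expansion means knowing one of `Θ³`. Two matrix identities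
(`mul_wordPrefix_zero`, `shiftMat_mul_wordH`) turn the cubed prefix back into letters of degree one:
the cube of `Hₙ` becomes `Hₙ₊₁`, and the block structure follows by induction (`blockTail_eq`).

All partial quotients have degree one, so `Θ` is badly approximable, hence irrational. The same
homography shows that the root is unique in the Laurent series field, and a unique irrational root
of a quartic in characteristic not two has degree four. Degree four excludes a relation `a + bΘ +
c/Θ = 0`, which would be quadratic.

For the Littlewood property, the expansion reads `A V …` with `A` ending just before `Hₙ₊₁` and `V`
equal to `Hₙ₊₁` followed by the first letters `X` of `Hₙ₊₂`. This `V` is a palindrome about three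
times as long as `A`. The continuant matrix of `A V Aᵗ` is then symmetric, and its off-diagonal
entry `q` makes both `qΘ` and `q/Θ` nearly polynomial (`exists_approx_of_palindrome`); the product
is at most `2^(2|A| + 2 - |V|)`, which tends to `0`. -/

theorem absv_zero : absv (0 : InvLaurent k) = 0 := by simp [absv]

theorem absv_of_ne_zero {F : InvLaurent k} (h : F ≠ 0) : absv F = (2 : ℝ) ^ (-F.order) := by
  simp [absv, h]

theorem absv_pos {F : InvLaurent k} (h : F ≠ 0) : 0 < absv F := by
  rw [absv_of_ne_zero h]; positivity

theorem absv_nonneg (F : InvLaurent k) : 0 ≤ absv F := by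
  by_cases h : F = 0
  · simp [h, absv_zero]
  · exact (absv_pos h).le

theorem ne_zero_of_absv_pos {F : InvLaurent k} (h : 0 < absv F) : F ≠ 0 := by
  rintro rfl
  simp [absv_zero] at h

theorem absv_mul (F G : InvLaurent k) : absv (F * G) = absv F * absv G := by
  by_cases hF : F = 0
  · simp [hF, absv_zero]
  by_cases hG : G = 0
  · simp [hG, absv_zero]
  rw [absv_of_ne_zero hF, absv_of_ne_zero hG, absv_of_ne_zero (mul_ne_zero hF hG),
    HahnSeries.order_mul hF hG, neg_add, zpow_add₀ (by norm_num)]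

theorem absv_add_le (F G : InvLaurent k) : absv (F + G) ≤ max (absv F) (absv G) := by
  by_cases hF : F = 0
  · simp [hF]
  by_cases hG : G = 0
  · simp [hG]
  by_cases hFG : F + G = 0
  · rw [hFG, absv_zero]
    exact le_max_of_le_left (absv_nonneg F)
  rw [absv_of_ne_zero hF, absv_of_ne_zero hG, absv_of_ne_zero hFG, le_max_iff]
  rcases min_le_iff.mp (HahnSeries.min_order_le_order_add hFG) with h | h
  · exact Or.inl (zpow_le_zpow_right₀ (by norm_num) (by omega))
  · exact Or.inr (zpow_le_zpow_right₀ (by norm_num) (by omega))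

/-- The absolute value `absv`, bundled. -/
def absValue (k : Type*) [Field k] : AbsoluteValue (InvLaurent k) ℝ where
  toFun := absv
  map_mul' := absv_mul
  nonneg' := absv_nonneg
  eq_zero' _ := ⟨fun h => by_contra fun hF => (absv_pos hF).ne' h, fun h => h ▸ absv_zero⟩
  add_le' F G := (absv_add_le F G).trans (max_le_add_of_nonneg (absv_nonneg F) (absv_nonneg G))

theorem absv_one : absv (1 : InvLaurent k) = 1 := map_one (absValue k)

theorem absv_pow (F : InvLaurent k) (n : ℕ) : absv (F ^ n) = absv F ^ n := map_pow (absValue k) F n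

theorem absv_inv (F : InvLaurent k) : absv F⁻¹ = (absv F)⁻¹ := map_inv₀ (absValue k) F

theorem absv_div (F G : InvLaurent k) : absv (F / G) = absv F / absv G := map_div₀ (absValue k) F G

theorem absv_neg (F : InvLaurent k) : absv (-F) = absv F := (absValue k).map_neg F

theorem absv_sub_comm (F G : InvLaurent k) : absv (F - G) = absv (G - F) :=
  (absValue k).map_sub F G

theorem absv_add_eq_left {F G : InvLaurent k} (h : absv G < absv F) : absv (F + G) = absv F := by
  refine le_antisymm ((absv_add_le F G).trans (max_le le_rfl h.le)) ?_
  have := absv_add_le (F + G) (-G)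
  rw [add_neg_cancel_right, absv_neg, le_max_iff] at this
  exact this.resolve_right (not_le.mpr h)

theorem absv_sub_eq_left {F G : InvLaurent k} (h : absv G < absv F) : absv (F - G) = absv F := by
  rw [sub_eq_add_neg, absv_add_eq_left (by rwa [absv_neg])]

theorem absv_sub_eq_right {F G : InvLaurent k} (h : absv F < absv G) : absv (F - G) = absv G := by
  rw [absv_sub_comm, absv_sub_eq_left h]

theorem two_le_absv {F : InvLaurent k} (h : 1 < absv F) : 2 ≤ absv F := by
  have hF : F ≠ 0 := ne_zero_of_absv_pos (one_pos.trans h)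
  rw [absv_of_ne_zero hF] at h ⊢
  rw [one_lt_zpow_iff_right₀ (by norm_num)] at h
  calc (2 : ℝ) = 2 ^ (1 : ℤ) := by norm_num
    _ ≤ _ := zpow_le_zpow_right₀ (by norm_num) (by omega)

theorem absv_lt_one_iff {F : InvLaurent k} : absv F < 1 ↔ ∀ h : ℤ, h ≤ 0 → F.coeff h = 0 := by
  by_cases hF : F = 0
  · simp [hF, absv_zero]
  rw [absv_of_ne_zero hF, zpow_lt_one_iff_right₀ (by norm_num)]
  constructor
  · intro h i hi
    exact HahnSeries.coeff_eq_zero_of_lt_order (by omega)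
  · intro h
    by_contra hc
    exact hF (HahnSeries.coeff_order_eq_zero.mp (h _ (by omega)))

/-! ### Polynomials and polynomial parts -/

theorem coeff_polyPart (F : InvLaurent k) (h : ℤ) :
    (polyPart F).coeff h = if 0 < h then 0 else F.coeff h := by
  have := coeff_fracPart F h
  rw [fracPart, HahnSeries.coeff_sub] at this
  split_ifs with hh
  · simpa [hh] using this
  · simp only [hh, if_false] at this
    exact (sub_eq_zero.mp this).symm

theorem indet_pow (n : ℕ) : indet k ^ n = HahnSeries.single (-(n : ℤ)) (1 : k) := by
  rw [indet, HahnSeries.single_pow]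
  simp

theorem ofPoly_monomial (n : ℕ) (a : k) :
    ofPoly (monomial n a) = HahnSeries.single (-(n : ℤ)) a := by
  have : algebraMap k (InvLaurent k) a = HahnSeries.single 0 a := by
    simp [LaurentSeries.algebraMap_apply]
  rw [ofPoly, aeval_monomial, indet_pow, this, HahnSeries.single_mul_single, zero_add, mul_one]

theorem coeff_ofPoly (p : k[X]) (h : ℤ) :
    (ofPoly p).coeff h = if 0 < h then 0 else p.coeff (-h).toNat := by
  induction p using Polynomial.induction_on' with
  | add p q hp hq =>
    rw [map_add, HahnSeries.coeff_add, hp, hq, coeff_add]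
    split_ifs <;> simp
  | monomial n a =>
    rw [ofPoly_monomial, HahnSeries.coeff_single, coeff_monomial]
    split_ifs <;> first | rfl | omega

theorem ofPoly_X : ofPoly (X : k[X]) = indet k := aeval_X _

theorem ofPoly_injective : Function.Injective (ofPoly (k := k)) := by
  intro p q h
  ext n
  have := congrArg (fun F : InvLaurent k => F.coeff (-(n : ℤ))) h
  simpa [coeff_ofPoly, Int.natCast_nonneg n |>.not_gt] using this

theorem ofPoly_eq_zero {p : k[X]} : ofPoly p = 0 ↔ p = 0 := map_eq_zero_iff _ ofPoly_injective

theorem ofPoly_ne_zero {p : k[X]} (h : p ≠ 0) : ofPoly p ≠ 0 := ofPoly_eq_zero.not.mpr h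

theorem absv_ofPoly {p : k[X]} (h : p ≠ 0) : absv (ofPoly p) = 2 ^ p.natDegree := by
  have hF := ofPoly_ne_zero h
  have : (ofPoly p).order = -(p.natDegree : ℤ) := by
    refine le_antisymm (HahnSeries.order_le_of_coeff_ne_zero ?_) ?_
    · simpa [coeff_ofPoly] using h
    · rw [HahnSeries.le_order_iff_forall hF]
      intro i hi
      rw [coeff_ofPoly, if_neg (by omega), coeff_eq_zero_of_natDegree_lt (by omega)]
  rw [absv_of_ne_zero hF, this, neg_neg, zpow_natCast]

theorem one_le_absv_ofPoly {p : k[X]} (h : p ≠ 0) : 1 ≤ absv (ofPoly p) := by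
  rw [absv_ofPoly h]
  exact one_le_pow₀ (by norm_num)

theorem exists_ofPoly_eq_polyPart (F : InvLaurent k) : ∃ p : k[X], ofPoly p = polyPart F := by
  refine ⟨∑ i ∈ Finset.range ((-F.order).toNat + 1), monomial i (F.coeff (-(i : ℤ))), ?_⟩
  ext h
  rw [coeff_ofPoly, coeff_polyPart]
  split_ifs with hh
  · rfl
  · simp only [finsetSum_coeff, coeff_monomial, Finset.sum_ite_eq', Finset.mem_range]
    split_ifs with h1
    · congr 1; omega
    · by_cases hF : F = 0
      · simp [hF]
      · exact (HahnSeries.coeff_eq_zero_of_lt_order (by omega)).symm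

theorem fracPart_sub_ofPoly (F : InvLaurent k) (p : k[X]) : fracPart (F - ofPoly p) = fracPart F := by
  ext h
  simp only [coeff_fracPart, HahnSeries.coeff_sub, coeff_ofPoly]
  split_ifs <;> simp

theorem fracPart_of_absv_lt_one {F : InvLaurent k} (h : absv F < 1) : fracPart F = F := by
  rw [absv_lt_one_iff] at h
  ext i
  rw [coeff_fracPart]
  split_ifs with hi
  · rfl
  · exact (h i (by omega)).symm

theorem absv_fracPart_lt_one (F : InvLaurent k) : absv (fracPart F) < 1 := by
  rw [absv_lt_one_iff]
  intro h hh
  rw [coeff_fracPart, if_neg (by omega)]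

/-- Any polynomial approximant bounds the distance from above, so polynomial parts of the concrete
series never have to be computed. -/
theorem fracAbsv_le (F : InvLaurent k) (p : k[X]) : fracAbsv F ≤ absv (F - ofPoly p) := by
  rw [fracAbsv, ← fracPart_sub_ofPoly F p]
  by_cases h : absv (F - ofPoly p) < 1
  · rw [fracPart_of_absv_lt_one h]
  · exact (absv_fracPart_lt_one _).le.trans (not_lt.mp h)

theorem fracAbsv_nonneg (F : InvLaurent k) : 0 ≤ fracAbsv F := absv_nonneg _

theorem exists_fracAbsv_eq (F : InvLaurent k) : ∃ p : k[X], fracAbsv F = absv (F - ofPoly p) := by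
  obtain ⟨p, hp⟩ := exists_ofPoly_eq_polyPart F
  exact ⟨p, by rw [hp]; rfl⟩

theorem polyPart_fracPart_of_eq_add {F G : InvLaurent k} {p : k[X]} (h : F = ofPoly p + G)
    (hG : absv G < 1) : polyPart F = ofPoly p ∧ fracPart F = G := by
  have hf : fracPart F = G := by
    rw [← fracPart_sub_ofPoly F p, h, add_sub_cancel_left, fracPart_of_absv_lt_one hG]
  refine ⟨?_, hf⟩
  have : polyPart F = F - fracPart F := by rw [fracPart]; ring
  rw [this, hf, h]; ring

/-! ### Continued fractions -/

/-- The value of the finite continued fraction `[a₁, …, aₙ, z]`, where `w` is the word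
`a₁, …, aₙ`. -/
def cfEval (w : List k[X]) (z : InvLaurent k) : InvLaurent k :=
  w.foldr (fun a y => ofPoly a + y⁻¹) z

@[simp] theorem cfEval_nil (z : InvLaurent k) : cfEval [] z = z := rfl

@[simp] theorem cfEval_cons (a : k[X]) (w : List k[X]) (z : InvLaurent k) :
    cfEval (a :: w) z = ofPoly a + (cfEval w z)⁻¹ := rfl

theorem cfEval_append (v w : List k[X]) (z : InvLaurent k) :
    cfEval (v ++ w) z = cfEval v (cfEval w z) := List.foldr_append

theorem absv_inv_lt_one {z : InvLaurent k} (hz : 1 < absv z) : absv z⁻¹ < 1 := by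
  rw [absv_inv]
  exact inv_lt_one_of_one_lt₀ hz

theorem absv_ofPoly_add_inv {a : k[X]} (ha : 0 < a.natDegree) {z : InvLaurent k}
    (hz : 1 < absv z) : absv (ofPoly a + z⁻¹) = 2 ^ a.natDegree := by
  have ha0 : a ≠ 0 := by rintro rfl; simp at ha
  rw [absv_add_eq_left, absv_ofPoly ha0]
  exact (absv_inv_lt_one hz).trans_le (one_le_absv_ofPoly ha0)

theorem one_lt_absv_cfEval {w : List k[X]} (hw : ∀ a ∈ w, 0 < a.natDegree) {z : InvLaurent k}
    (hz : 1 < absv z) : 1 < absv (cfEval w z) := by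
  induction w with
  | nil => exact hz
  | cons a w ih =>
    have ha := hw a List.mem_cons_self
    rw [cfEval_cons, absv_ofPoly_add_inv ha (ih fun b hb => hw b (List.mem_cons_of_mem _ hb))]
    exact one_lt_pow₀ (by norm_num) ha.ne'

theorem absv_cfEval_eq_two {w : List k[X]} (hw : ∀ a ∈ w, a.natDegree = 1) {z : InvLaurent k}
    (hz : absv z = 2) : absv (cfEval w z) = 2 := by
  cases w with
  | nil => exact hz
  | cons a w =>
    have ha := hw a List.mem_cons_self
    rw [cfEval_cons, absv_ofPoly_add_inv (by omega), ha, pow_one]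
    refine one_lt_absv_cfEval (fun b hb => ?_) (by rw [hz]; norm_num)
    rw [hw b (List.mem_cons_of_mem _ hb)]
    exact one_pos

theorem completeQuotient_cfEval {w : List k[X]} (hw : ∀ a ∈ w, 0 < a.natDegree)
    {z : InvLaurent k} (hz : 1 < absv z) (i : ℕ) (hi : i ≤ w.length) :
    completeQuotient (cfEval w z) i = cfEval (w.drop i) z := by
  induction i with
  | zero => rfl
  | succ i ih =>
    have hlt : 1 < absv (cfEval (w.drop (i + 1)) z) :=
      one_lt_absv_cfEval (fun a ha => hw a (List.mem_of_mem_drop ha)) hz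
    rw [completeQuotient, ih (by omega), List.drop_eq_getElem_cons (by omega), cfEval_cons,
      (polyPart_fracPart_of_eq_add rfl (absv_inv_lt_one hlt)).2, inv_inv]

/-- A series that starts with arbitrarily long prefixes of `a` has the expansion `a`. -/
theorem hasContFrac_of_prefixes {F : InvLaurent k} {a : ℕ → k[X]}
    (h : ∀ n, ∃ (w : List k[X]) (z : InvLaurent k) (hn : n < w.length),
      (∀ b ∈ w, 0 < b.natDegree) ∧ 1 < absv z ∧ F = cfEval w z ∧ w[n] = a n) :
    HasContFrac F a := by
  intro n
  obtain ⟨w, z, hn, hw, hz, rfl, hwn⟩ := h n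
  have hlt : 1 < absv (cfEval (w.drop (n + 1)) z) :=
    one_lt_absv_cfEval (fun a ha => hw a (List.mem_of_mem_drop ha)) hz
  rw [completeQuotient_cfEval hw hz n hn.le, List.drop_eq_getElem_cons hn, cfEval_cons]
  have := polyPart_fracPart_of_eq_add rfl (absv_inv_lt_one hlt) (p := w[n])
  rw [this.1, this.2, hwn]
  exact ⟨inv_ne_zero (ne_zero_of_absv_pos (one_pos.trans hlt)), rfl⟩

theorem completeQuotient_succ' (F : InvLaurent k) (n : ℕ) :
    completeQuotient F (n + 1) = completeQuotient (fracPart F)⁻¹ n := by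
  induction n with
  | zero => rfl
  | succ n ih => rw [completeQuotient, ih]; rfl

/-! ### Badly approximable series -/

/-- `|q| · |qF - p| ≥ c` for all polynomials `q ≠ 0` and `p`. -/
def BadWith (c : ℝ) (F : InvLaurent k) : Prop :=
  ∀ q : k[X], q ≠ 0 → ∀ p : k[X], c ≤ absv (ofPoly q) * absv (ofPoly q * F - ofPoly p)

theorem BadWith.mem_bad {c : ℝ} {F : InvLaurent k} (hc : 0 < c) (h : BadWith c F) : F ∈ Bad k := by
  have : Nonempty {q : k[X] // q ≠ 0} := ⟨⟨1, one_ne_zero⟩⟩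
  refine hc.trans_le (le_ciInf fun q => ?_)
  obtain ⟨p, hp⟩ := exists_fracAbsv_eq (ofPoly q.1 * F)
  rw [hp]
  exact h q.1 q.2 p

/-- Exchanging the roles of `p` and `q` turns an approximation of `F⁻¹` into one of `F`. The three
terms of the minimum cover this case, the case where `p` dominates `q / F`, and the case `p = 0`. -/
theorem BadWith.inv {c : ℝ} {F : InvLaurent k} (hF : F ≠ 0) (h : BadWith c F) :
    BadWith (min (min c 1) (absv F)⁻¹) F⁻¹ := by
  intro q hq p
  have hq1 := one_le_absv_ofPoly hq
  have hF' := absv_pos hF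
  by_cases hp : p = 0
  · refine (min_le_right _ _).trans ?_
    rw [hp, map_zero, sub_zero, absv_mul, absv_inv]
    rw [← mul_assoc]
    exact le_mul_of_one_le_left (inv_pos.mpr hF').le (one_le_mul_of_one_le_of_one_le hq1 hq1)
  refine (min_le_left _ _).trans ?_
  rcases lt_or_ge (absv (ofPoly q * F⁻¹)) (absv (ofPoly p)) with hlt | hge
  · refine (min_le_right _ _).trans ?_
    rw [absv_sub_eq_right hlt]
    exact one_le_mul_of_one_le_of_one_le hq1 (one_le_absv_ofPoly hp)
  · refine (min_le_left _ _).trans ((h p hp q).trans ?_)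
    have heq : ofPoly p * F - ofPoly q = -(F * (ofPoly q * F⁻¹ - ofPoly p)) := by
      field_simp
      ring
    rw [heq, absv_neg, absv_mul, ← mul_assoc]
    refine mul_le_mul_of_nonneg_right ?_ (absv_nonneg _)
    rw [absv_mul, absv_inv, ← div_eq_mul_inv] at hge
    exact (le_div_iff₀ hF').mp hge

theorem BadWith.ofPoly_mul_ne {c : ℝ} {F : InvLaurent k} (hc : 0 < c) (h : BadWith c F) {q : k[X]}
    (hq : q ≠ 0) (p : k[X]) : ofPoly q * F ≠ ofPoly p := by
  intro he
  have := h q hq p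
  rw [he, sub_self, absv_zero, mul_zero] at this
  exact this.not_gt hc

/-- A series whose partial quotients have bounded degrees is badly approximable. -/
theorem badWith_of_completeQuotient_le {D : ℝ} {F : InvLaurent k}
    (hfr : ∀ n, fracPart (completeQuotient F n) ≠ 0)
    (hD : ∀ n, absv (completeQuotient F (n + 1)) ≤ D) : BadWith D⁻¹ F := by
  intro q
  induction hd : q.natDegree using Nat.strong_induction_on generalizing q F with
  | _ d ih =>
    intro hq p
    set z := (fracPart F)⁻¹ with hz
    have hf0 : fracPart F ≠ 0 := hfr 0
    have hz0 : z ≠ 0 := inv_ne_zero hf0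
    have hz1 : 1 < absv z := by
      rw [hz, absv_inv]
      exact (one_lt_inv₀ (absv_pos hf0)).mpr (absv_fracPart_lt_one F)
    have hzpos : 0 < absv z := one_pos.trans hz1
    have hzD : absv z ≤ D := hD 0
    have hDpos : 0 < D := hzpos.trans_le hzD
    have hq1 := one_le_absv_ofPoly hq
    obtain ⟨a, ha⟩ := exists_ofPoly_eq_polyPart F
    have hFa : F = ofPoly a + z⁻¹ := by
      rw [hz, inv_inv, ha, fracPart]; ring
    -- One step of Euclid's algorithm. Unless `q / z` and `p - aq` have equal size, no cancellation
    -- occurs and the bound is immediate; if they do, `p - aq` is a denominator of smaller degree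
    -- for the next complete quotient `z`.
    have key : ofPoly q * F - ofPoly p = ofPoly q * z⁻¹ - ofPoly (p - a * q) := by
      rw [hFa, map_sub, map_mul]; ring
    rw [key]
    have hbase : D⁻¹ ≤ absv (ofPoly q) * absv (ofPoly q * z⁻¹) := by
      rw [absv_mul, absv_inv, ← mul_assoc]
      exact (inv_anti₀ hzpos hzD).trans (le_mul_of_one_le_left (inv_pos.mpr hzpos).le
        (one_le_mul_of_one_le_of_one_le hq1 hq1))
    rcases lt_trichotomy (absv (ofPoly q * z⁻¹)) (absv (ofPoly (p - a * q))) with hlt | heq | hgt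
    · rw [absv_sub_eq_right hlt]
      exact hbase.trans (mul_le_mul_of_nonneg_left hlt.le (absv_nonneg _))
    · have hq'0 : p - a * q ≠ 0 := by
        intro h0
        rw [h0, map_zero, absv_zero] at heq
        exact (absv_pos (mul_ne_zero (ofPoly_ne_zero hq) (inv_ne_zero hz0))).ne' heq
      have hqq : absv (ofPoly q) = absv (ofPoly (p - a * q)) * absv z := by
        rw [← heq, absv_mul, absv_inv, inv_mul_cancel_right₀ hzpos.ne']
      have hdeg : (p - a * q).natDegree < d := by
        have h1 := hqq
        rw [absv_ofPoly hq, absv_ofPoly hq'0] at h1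
        have h2 : (0 : ℝ) < 2 ^ (p - a * q).natDegree := by positivity
        have h3 : (2 : ℝ) ^ (p - a * q).natDegree < 2 ^ q.natDegree := by nlinarith
        rw [← hd]
        exact (pow_lt_pow_iff_right₀ (by norm_num)).mp h3
      have hIH := ih _ hdeg (F := z) (fun n => by rw [hz, ← completeQuotient_succ']; exact hfr _)
        (fun n => by rw [hz, ← completeQuotient_succ']; exact hD _) (p - a * q) rfl hq'0 q
      refine hIH.trans_eq ?_
      have : ofPoly (p - a * q) * z - ofPoly q = -(z * (ofPoly q * z⁻¹ - ofPoly (p - a * q))) := by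
        field_simp
        ring
      rw [this, absv_neg, absv_mul, hqq]
      ring
    · rw [absv_sub_eq_left hgt]
      exact hbase

theorem HasContFrac.badWith {F : InvLaurent k} {a : ℕ → k[X]} (h : HasContFrac F a) {d : ℕ}
    (hd : ∀ n, (a n).natDegree ≤ d) : BadWith ((2 : ℝ) ^ d)⁻¹ F := by
  refine badWith_of_completeQuotient_le (fun n => (h n).1) fun n => ?_
  set G := completeQuotient F (n + 1)
  have hG : G = ofPoly (a (n + 1)) + fracPart G := by
    rw [← (h (n + 1)).2, fracPart]; ring
  rw [hG]
  refine (absv_add_le _ _).trans (max_le ?_ ?_)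
  · by_cases ha : a (n + 1) = 0
    · rw [ha, map_zero, absv_zero]; positivity
    · rw [absv_ofPoly ha]
      exact pow_le_pow_right₀ (by norm_num) (hd _)
  · exact (absv_fracPart_lt_one G).le.trans (one_le_pow₀ (by norm_num))

/-! ### Continuants -/

/-- The product of the matrices `!![a, 1; 1, 0]` over the letters `a` of a word. -/
def cfMat {R : Type*} [CommRing R] (w : List R) : Matrix (Fin 2) (Fin 2) R :=
  (w.map fun a => !![a, 1; 1, 0]).prod

section cfMat

variable {R : Type*} [CommRing R]

@[simp] theorem cfMat_nil : cfMat ([] : List R) = 1 := rfl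

@[simp] theorem cfMat_cons (a : R) (w : List R) : cfMat (a :: w) = !![a, 1; 1, 0] * cfMat w := by
  simp [cfMat]

theorem cfMat_append (v w : List R) : cfMat (v ++ w) = cfMat v * cfMat w := by
  simp [cfMat]

theorem cfMat_replicate (n : ℕ) (a : R) : cfMat (List.replicate n a) = !![a, 1; 1, 0] ^ n := by
  simp [cfMat]

/-- Each factor is symmetric, so transposition only reverses the product; palindromes therefore have
symmetric matrices. -/
theorem cfMat_reverse (w : List R) : cfMat w.reverse = (cfMat w).transpose := by
  induction w with
  | nil => simp
  | cons a w ih =>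
    rw [List.reverse_cons, cfMat_append, ih, cfMat_cons, cfMat_cons, cfMat_nil, mul_one,
      Matrix.transpose_mul]
    congr 1
    ext i j
    fin_cases i <;> fin_cases j <;> rfl

theorem det_cfMat (w : List R) : (cfMat w).det = (-1) ^ w.length := by
  induction w with
  | nil => simp
  | cons a w ih =>
    rw [cfMat_cons, Matrix.det_mul, ih, Matrix.det_fin_two_of, List.length_cons, pow_succ]
    ring

end cfMat

theorem absv_ofPoly_cfMat_le {w : List k[X]} (hw : ∀ a ∈ w, a.natDegree = 1) (i j : Fin 2) :
    absv (ofPoly (cfMat w i j)) ≤ 2 ^ w.length := by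
  induction w generalizing i with
  | nil =>
    rw [cfMat_nil, Matrix.one_apply]
    split_ifs <;> simp [absv_one, absv_zero]
  | cons a w ih =>
    have ih' := fun i => ih (fun b hb => hw b (List.mem_cons_of_mem _ hb)) i
    have ha := hw a List.mem_cons_self
    have ha2 : absv (ofPoly a) = 2 := by
      rw [absv_ofPoly (by rintro rfl; simp at ha), ha, pow_one]
    have hpos : (0 : ℝ) < 2 ^ w.length := by positivity
    rw [cfMat_cons, Matrix.mul_apply, Fin.sum_univ_two, List.length_cons, pow_succ]
    fin_cases i
    · simp only [Fin.zero_eta, Matrix.of_apply, Matrix.cons_val_zero, Matrix.cons_val_one, one_mul,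
        map_add, map_mul]
      refine (absv_add_le _ _).trans (max_le ?_ ?_)
      · rw [absv_mul, ha2, mul_comm]
        exact mul_le_mul_of_nonneg_right (ih' 0) (by norm_num)
      · linarith [ih' 1]
    · simp
      linarith [ih' 0]

/-- The matrix `cfMat w` acts on `(z, 1)` as the continued fraction `[w, z]`. -/
theorem cfMat_mul_eq {w : List k[X]} (hw : ∀ a ∈ w, 0 < a.natDegree) {z : InvLaurent k}
    (hz : 1 < absv z) : ∃ l : InvLaurent k, 2 ^ w.length ≤ absv l ∧
      ofPoly (cfMat w 0 0) * z + ofPoly (cfMat w 0 1) = l * cfEval w z ∧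
      ofPoly (cfMat w 1 0) * z + ofPoly (cfMat w 1 1) = l := by
  induction w with
  | nil => exact ⟨1, by simp [absv_one]⟩
  | cons a w ih =>
    have hw' : ∀ b ∈ w, 0 < b.natDegree := fun b hb => hw b (List.mem_cons_of_mem _ hb)
    obtain ⟨l, hl, h0, h1⟩ := ih hw'
    have hc := one_lt_absv_cfEval hw' hz
    have hc0 : cfEval w z ≠ 0 := ne_zero_of_absv_pos (one_pos.trans hc)
    -- The scalar `l` is the product of the complete quotients, each of absolute value at least `2`.
    refine ⟨l * cfEval w z, ?_, ?_, ?_⟩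
    · rw [absv_mul, List.length_cons, pow_succ]
      exact mul_le_mul hl (two_le_absv hc) (by norm_num) (absv_nonneg _)
    · simp only [cfMat_cons, Matrix.mul_apply, Fin.sum_univ_two, Matrix.of_apply,
        Matrix.cons_val_zero, Matrix.cons_val_one, one_mul, map_add, map_mul, cfEval_cons]
      field_simp
      linear_combination ofPoly a * h0 + h1
    · simp only [cfMat_cons, Matrix.mul_apply, Fin.sum_univ_two, Matrix.of_apply,
        Matrix.cons_val_zero, Matrix.cons_val_one, one_mul, zero_mul, add_zero]
      exact h0

/-! ### The Littlewood conjecture -/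

/-- If the expansion of `Θ` starts with `A V`, where `V` is a palindrome, then the symmetric
matrix `cfMat (A V Aᵗ)` yields a simultaneous approximation to `Θ` and `Θ⁻¹`. -/
theorem exists_approx_of_palindrome {A V : List k[X]} (hA : ∀ a ∈ A, a.natDegree = 1)
    (hV : ∀ a ∈ V, a.natDegree = 1) (hrev : V.reverse = V) (hlen : 2 ≤ V.length)
    {z : InvLaurent k} (hz : absv z = 2) :
    ∃ q : k[X], q ≠ 0 ∧ absv (ofPoly q) * fracAbsv (ofPoly q * cfEval (A ++ V) z) *
      fracAbsv (ofPoly q * (cfEval (A ++ V) z)⁻¹) ≤ 2 ^ (2 * A.length + 2) / 2 ^ V.length := by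
  have hAV : ∀ a ∈ A ++ V, a.natDegree = 1 := by
    intro a ha
    rcases List.mem_append.mp ha with h | h
    exacts [hA a h, hV a h]
  have hz1 : 1 < absv z := by rw [hz]; norm_num
  set F := cfEval (A ++ V) z with hF
  have hF2 : absv F = 2 := absv_cfEval_eq_two hAV hz
  have hF0 : F ≠ 0 := ne_zero_of_absv_pos (by rw [hF2]; norm_num)
  obtain ⟨l, hl, h0, h1⟩ := cfMat_mul_eq (fun a ha => by rw [hAV a ha]; exact one_pos) hz1
  rw [← hF] at h0
  set M := cfMat (A ++ V) with hM
  set N := cfMat (A ++ V ++ A.reverse) with hN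
  have hlpos : 0 < absv l := lt_of_lt_of_le (by positivity) hl
  have hl0 : l ≠ 0 := ne_zero_of_absv_pos hlpos
  have hdet : ofPoly (M 0 0) * ofPoly (M 1 1) - ofPoly (M 0 1) * ofPoly (M 1 0) =
      (-1) ^ (A ++ V).length := by
    have := congrArg ofPoly (det_cfMat (A ++ V))
    simpa [Matrix.det_fin_two, ← hM] using this
  have habs : absv ((-1 : InvLaurent k) ^ (A ++ V).length) = 1 := by
    rw [absv_pow, absv_neg, absv_one, one_pow]
  have hlen' : (A ++ V).length = A.length + V.length := List.length_append
  -- Multiplied by `l`, the two errors become, up to sign, `det M` and `det M * z`, of absolute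
  -- values `1` and `2`.
  have hbound : ∀ j, absv (ofPoly (M 1 j) * F - ofPoly (M 0 j)) ≤
      2 / 2 ^ (A.length + V.length) := by
    have hx : ∀ x y : InvLaurent k, l * x = y → absv y ≤ 2 →
        absv x ≤ 2 / 2 ^ (A.length + V.length) := by
      intro x y hxy hy
      rw [← hlen']
      have : absv x = absv y / absv l := by rw [← hxy, absv_mul]; field_simp
      rw [this]
      exact div_le_div₀ (by norm_num) hy (by positivity) hl
    intro j
    fin_cases j
    · refine hx _ (-(-1) ^ (A ++ V).length) ?_ (by rw [absv_neg, habs]; norm_num)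
      rw [← hdet]
      simp only [Fin.zero_eta]
      linear_combination -ofPoly (M 1 0) * h0 + ofPoly (M 0 0) * h1
    · refine hx _ ((-1) ^ (A ++ V).length * z) ?_ (by rw [absv_mul, habs, hz, one_mul])
      rw [← hdet]
      simp only [Fin.mk_one]
      linear_combination -ofPoly (M 1 1) * h0 + ofPoly (M 0 1) * h1
  have hNM : N = M * cfMat A.reverse := cfMat_append _ _
  have hApos : (0 : ℝ) < 2 ^ A.length := by positivity
  -- The columns of `N` combine those of `M` with coefficients of size at most `2 ^ A.length`; this
  -- loss leaves exactly the gain due to `V`.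
  have hNbound : ∀ j, absv (ofPoly (N 1 j) * F - ofPoly (N 0 j)) ≤ 2 / 2 ^ V.length := by
    intro j
    have : ofPoly (N 1 j) * F - ofPoly (N 0 j) =
        ofPoly (cfMat A.reverse 0 j) * (ofPoly (M 1 0) * F - ofPoly (M 0 0)) +
        ofPoly (cfMat A.reverse 1 j) * (ofPoly (M 1 1) * F - ofPoly (M 0 1)) := by
      rw [hNM, Matrix.mul_apply, Matrix.mul_apply, Fin.sum_univ_two, Fin.sum_univ_two]
      simp only [map_add, map_mul]
      ring
    rw [this]
    have hterm : ∀ i, absv (ofPoly (cfMat A.reverse i j) *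
        (ofPoly (M 1 i) * F - ofPoly (M 0 i))) ≤ 2 / 2 ^ V.length := by
      intro i
      have hAi := absv_ofPoly_cfMat_le (w := A.reverse)
        (fun a ha => hA a (List.mem_reverse.mp ha)) i j
      rw [List.length_reverse] at hAi
      calc _ = _ := absv_mul _ _
        _ ≤ 2 ^ A.length * (2 / 2 ^ (A.length + V.length)) :=
          mul_le_mul hAi (hbound i) (absv_nonneg _) hApos.le
        _ = _ := by rw [pow_add]; field_simp
    exact (absv_add_le _ _).trans (max_le (hterm 0) (hterm 1))
  have hsymm : N 0 1 = N 1 0 := by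
    have : N.transpose = N := by
      rw [hN, ← cfMat_reverse]
      simp [hrev]
    exact congrFun (congrFun this 1) 0
  have hVlt : (2 : ℝ) / 2 ^ V.length < 1 := by
    rw [div_lt_one (by positivity)]
    calc (2 : ℝ) < 2 ^ 2 := by norm_num
      _ ≤ _ := pow_le_pow_right₀ (by norm_num) hlen
  refine ⟨N 1 0, ?_, ?_⟩
  -- If `q` vanished, the invertible matrix `N` would have a nonzero polynomial `N 0 0` of absolute
  -- value less than `1`.
  · intro hq
    have hP : N 0 0 ≠ 0 := by
      intro hP
      have := det_cfMat (A ++ V ++ A.reverse)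
      rw [Matrix.det_fin_two, ← hN, hP, hq, mul_zero, zero_mul, sub_zero] at this
      exact pow_ne_zero _ (neg_ne_zero.mpr one_ne_zero) this.symm
    have := hNbound 0
    rw [hq, map_zero, zero_mul, zero_sub, absv_neg] at this
    linarith [one_le_absv_ofPoly hP]
  · have hq : absv (ofPoly (N 1 0)) ≤ 2 ^ (2 * A.length + V.length) := by
      refine (absv_ofPoly_cfMat_le (w := A ++ V ++ A.reverse) ?_ 1 0).trans_eq ?_
      · intro a ha
        rcases List.mem_append.mp ha with h | h
        exacts [hAV a h, hA a (List.mem_reverse.mp h)]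
      · congr 1
        simp only [List.length_append, List.length_reverse]
        omega
    have h1 : fracAbsv (ofPoly (N 1 0) * F) ≤ 2 / 2 ^ V.length :=
      (fracAbsv_le _ (N 0 0)).trans (hNbound 0)
    -- By symmetry `q` is also the numerator `N 0 1` of the second column, so `N 1 1 / q`
    -- approximates `F⁻¹`.
    have h2 : fracAbsv (ofPoly (N 1 0) * F⁻¹) ≤ 2 / 2 ^ V.length := by
      refine (fracAbsv_le _ (N 1 1)).trans ?_
      have : ofPoly (N 1 0) * F⁻¹ - ofPoly (N 1 1) =
          -(F⁻¹ * (ofPoly (N 1 1) * F - ofPoly (N 0 1))) := by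
        rw [hsymm]
        field_simp
        ring
      rw [this, absv_neg, absv_mul, absv_inv, hF2]
      have := hNbound 1
      have := absv_nonneg (ofPoly (N 1 1) * F - ofPoly (N 0 1))
      linarith
    calc _ ≤ (2 : ℝ) ^ (2 * A.length + V.length) * (2 / 2 ^ V.length) * (2 / 2 ^ V.length) := by
          refine mul_le_mul (mul_le_mul hq h1 (fracAbsv_nonneg _) (by positivity)) h2
            (fracAbsv_nonneg _) (by positivity)
      _ = _ := by
          rw [pow_add, pow_add]
          field_simp

theorem littlewood_of_forall_exists {Θ Φ : InvLaurent k}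
    (h : ∀ ε : ℝ, 0 < ε → ∃ q : k[X], q ≠ 0 ∧
      absv (ofPoly q) * fracAbsv (ofPoly q * Θ) * fracAbsv (ofPoly q * Φ) ≤ ε) :
    Littlewood Θ Φ := by
  have hnn : ∀ q : {q : k[X] // q ≠ 0},
      0 ≤ absv (ofPoly q.1) * fracAbsv (ofPoly q.1 * Θ) * fracAbsv (ofPoly q.1 * Φ) := fun q =>
    mul_nonneg (mul_nonneg (absv_nonneg _) (fracAbsv_nonneg _)) (fracAbsv_nonneg _)
  refine le_antisymm (le_of_forall_pos_le_add fun ε hε => ?_) (Real.iInf_nonneg hnn)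
  obtain ⟨q, hq, hle⟩ := h ε hε
  rw [zero_add]
  exact (ciInf_le ⟨0, by rintro _ ⟨q, rfl⟩; exact hnn q⟩ (⟨q, hq⟩ : {q : k[X] // q ≠ 0})).trans hle

/-! ### Words over `F₃[X]` -/

section CharThree

variable {R : Type*} [CommRing R]

/-- A matrix of determinant `-(x ^ 2 + 1)` that intertwines `!![x ^ 3, 1; 1, 0]` and
`!![x, 1; 1, 0] ^ 3` in characteristic three. -/
def cubeMat (x : R) : Matrix (Fin 2) (Fin 2) R := !![0, x ^ 2 + 1; 1, x - x ^ 3]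

/-- The matrix of the homography by which `[Hₙ₊₁, Hₙ₊₂, …]` is obtained from the cube of
`[Hₙ, Hₙ₊₁, …]`. -/
def shiftMat (x : R) : Matrix (Fin 2) (Fin 2) R := !![x ^ 3 - x, 1; x ^ 2 + 1, 0]

variable [CharP R 3]

theorem cubeMat_mul (x : R) :
    cubeMat x * !![x ^ 3, 1; 1, 0] = !![x, 1; 1, 0] ^ 3 * cubeMat x := by
  have h3 : (3 : R) = 0 := CharP.ofNat_eq_zero R 3
  simp only [cubeMat, pow_succ, pow_zero, one_mul, Matrix.mul_fin_two]
  ext i j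
  fin_cases i <;> fin_cases j <;> simp <;> grind

theorem cubeMat_mul_pow (x : R) (n : ℕ) :
    cubeMat x * !![x ^ 3, 1; 1, 0] ^ n = !![x, 1; 1, 0] ^ (3 * n) * cubeMat x := by
  induction n with
  | zero => simp
  | succ n ih =>
    rw [pow_succ, ← mul_assoc, ih, mul_assoc, cubeMat_mul, ← mul_assoc, ← pow_add, Nat.mul_succ]

/-- These four extra letters `x` account for `3(3ⁿ - 2) + 4 = 3ⁿ⁺¹ - 2`. -/
theorem pow_four_mul_cubeMat (x : R) : !![x, 1; 1, 0] ^ 4 * cubeMat x = shiftMat x := by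
  have h3 : (3 : R) = 0 := CharP.ofNat_eq_zero R 3
  simp only [cubeMat, shiftMat, pow_succ, pow_zero, one_mul, Matrix.mul_fin_two]
  ext i j
  fin_cases i <;> fin_cases j <;> simp <;> grind

/-- Crossing the two middle letters changes `x` to `-x` and `e` to `-e`: this is why `Hₙ` has a run
of `2X = -X` and why `ε` alternates with `n`. -/
theorem cubeMat_mul_mul (x e : R) (he : e ^ 2 = 1) :
    cubeMat x * (!![x ^ 3 + e, 1; 1, 0] * !![-x ^ 3 + e, 1; 1, 0]) =
      -(!![x - e, 1; 1, 0] * !![-x - e, 1; 1, 0] * shiftMat (-x)) := by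
  have h3 : (3 : R) = 0 := CharP.ofNat_eq_zero R 3
  simp only [cubeMat, shiftMat, pow_succ, pow_zero, one_mul, Matrix.mul_fin_two]
  ext i j
  fin_cases i <;> fin_cases j <;> simp <;> grind

/-- `cubeMat` is pushed through the word from left to right: it triples each run and switches
between `x` and `-x` at each pair of middle letters. Two switches restore `x` and cancel the two
signs. -/
theorem shiftMat_mul_cfMat (x e : R) (he : e ^ 2 = 1) (n : ℕ) :
    shiftMat x * cfMat (List.replicate n (x ^ 3) ++ [x ^ 3 + e, -x ^ 3 + e] ++
      List.replicate n (-x ^ 3) ++ [-x ^ 3 + e, x ^ 3 + e]) =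
    cfMat (List.replicate (3 * n + 4) x ++ [x - e, -x - e] ++
      List.replicate (3 * n + 4) (-x) ++ [-x - e, x - e]) * shiftMat x := by
  have hneg : (-x) ^ 3 = -x ^ 3 := by ring
  have h1 := cubeMat_mul_pow x n
  have h2 := cubeMat_mul_mul x e he
  have h3 := cubeMat_mul_pow (-x) n
  have h4 := cubeMat_mul_mul (-x) e he
  rw [hneg] at h3 h4
  simp only [neg_neg] at h4
  simp only [cfMat_append, cfMat_replicate, cfMat_cons, cfMat_nil, mul_one, add_comm (3 * n) 4,
    pow_add]
  rw [← pow_four_mul_cubeMat x]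
  generalize hMx : !![x, 1; 1, 0] = Mx at *
  have h1' := pow_four_mul_cubeMat x
  have h3' := pow_four_mul_cubeMat (-x)
  rw [hMx] at h1'
  generalize !![-x, 1; 1, 0] = My at *
  generalize !![x ^ 3, 1; 1, 0] = Cx at *
  generalize !![-x ^ 3, 1; 1, 0] = Cy at *
  generalize !![x ^ 3 + e, 1; 1, 0] * !![-x ^ 3 + e, 1; 1, 0] = Dx at *
  generalize !![-x ^ 3 + e, 1; 1, 0] * !![x ^ 3 + e, 1; 1, 0] = Dy at *
  calc _ = Mx ^ 4 * (cubeMat x * Cx ^ n) * Dx * Cy ^ n * Dy := by simp only [mul_assoc]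
    _ = Mx ^ 4 * Mx ^ (3 * n) * (cubeMat x * Dx) * Cy ^ n * Dy := by
      rw [h1]; simp only [mul_assoc]
    _ = -(Mx ^ 4 * Mx ^ (3 * n) * (!![x - e, 1; 1, 0] * !![-x - e, 1; 1, 0]) * My ^ 4 *
        (cubeMat (-x) * Cy ^ n) * Dy) := by
      rw [h2, ← h3']; simp only [mul_assoc, mul_neg, neg_mul]
    _ = -(Mx ^ 4 * Mx ^ (3 * n) * (!![x - e, 1; 1, 0] * !![-x - e, 1; 1, 0]) * My ^ 4 *
        My ^ (3 * n) * (cubeMat (-x) * Dy)) := by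
      rw [h3]; simp only [mul_assoc]
    _ = _ := by
      rw [h4, h1']; simp only [mul_assoc, mul_neg, neg_neg]

end CharThree

theorem three_eq_zero : (3 : (ZMod 3)[X]) = 0 := CharP.ofNat_eq_zero _ 3

theorem two_mul_X_eq_neg : (2 * X : (ZMod 3)[X]) = -X := by
  linear_combination X * three_eq_zero

theorem eps_sq (n : ℕ) : eps n ^ 2 = 1 := by
  unfold eps
  split_ifs
  · linear_combination three_eq_zero
  · exact one_pow 2

theorem eps_succ (n : ℕ) : eps (n + 1) = -eps n := by
  simp only [eps, Nat.odd_add_one]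
  split_ifs
  · linear_combination three_eq_zero
  · linear_combination three_eq_zero

theorem map_pow_wordH (n : ℕ) : (wordH n).map (· ^ 3) =
    List.replicate (3 ^ n - 2) (X ^ 3) ++ [X ^ 3 + eps n, -X ^ 3 + eps n] ++
      List.replicate (3 ^ n - 2) (-X ^ 3) ++ [-X ^ 3 + eps n, X ^ 3 + eps n] := by
  have he : eps n ^ 3 = eps n := by rw [pow_succ, eps_sq, one_mul]
  have h1 : (X + eps n) ^ 3 = X ^ 3 + eps n := by rw [add_pow_char, he]
  have h2 : (-X + eps n) ^ 3 = -X ^ 3 + eps n := by rw [add_pow_char, he]; ring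
  have h3 : (-X : (ZMod 3)[X]) ^ 3 = -X ^ 3 := by ring
  simp only [wordH, two_mul_X_eq_neg, List.map_append, List.map_replicate, List.map_cons,
    List.map_nil, h1, h2, h3]

theorem shiftMat_mul_wordH {n : ℕ} (hn : 1 ≤ n) :
    shiftMat X * cfMat ((wordH n).map (· ^ 3)) = cfMat (wordH (n + 1)) * shiftMat X := by
  have h2 : 2 ≤ 3 ^ n := (by norm_num : 2 ≤ 3 ^ 1).trans (Nat.pow_le_pow_right (by norm_num) hn)
  have hlen : 3 ^ (n + 1) - 2 = 3 * (3 ^ n - 2) + 4 := by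
    rw [pow_succ]; omega
  rw [map_pow_wordH, shiftMat_mul_cfMat X (eps n) (eps_sq n), wordH, two_mul_X_eq_neg, eps_succ,
    hlen]
  simp only [sub_eq_add_neg]

/-- Base case of the block recursion: the matrix on the left is that of the homography giving
`blockTail Θ 0` from `Θ ^ 3`. -/
theorem mul_wordPrefix_zero :
    !![1, 2 * X + 1; 0, X ^ 2 + 1] * cfMat ((wordPrefix 0).map (· ^ 3)) =
      cfMat (wordH 1) * shiftMat (X : (ZMod 3)[X]) := by
  have h3 := three_eq_zero
  have h1 : eps 1 = 2 := by simp [eps]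
  rw [wordPrefix, wordH, h1]
  simp only [shiftMat, List.map_cons, List.map_nil, cfMat_cons, cfMat_nil, cfMat_append,
    cfMat_replicate, Matrix.mul_fin_two, mul_one]
  norm_num
  refine ⟨⟨?_, ?_⟩, ?_, ?_⟩ <;> grind

theorem natDegree_of_mem_wordH {n : ℕ} {a : (ZMod 3)[X]} (ha : a ∈ wordH n) : a.natDegree = 1 := by
  have h2 : (2 : ZMod 3) ≠ 0 := by decide
  obtain ⟨c, hc⟩ : ∃ c : ZMod 3, eps n = C c := by
    unfold eps
    split_ifs
    exacts [⟨2, rfl⟩, ⟨1, rfl⟩]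
  have e2 : (2 * X : (ZMod 3)[X]) = C 2 * X := rfl
  simp only [wordH, hc, e2, List.mem_append, List.mem_replicate, List.mem_cons, List.not_mem_nil,
    or_false] at ha
  rcases ha with ((⟨-, rfl⟩ | rfl | rfl) | ⟨-, rfl⟩) | rfl | rfl
  · exact natDegree_X
  · exact natDegree_X_add_C c
  · exact natDegree_linear h2
  · exact natDegree_C_mul_X _ h2
  · exact natDegree_linear h2
  · exact natDegree_X_add_C c

theorem natDegree_of_mem_wordPrefix {N : ℕ} {a : (ZMod 3)[X]} (ha : a ∈ wordPrefix N) :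
    a.natDegree = 1 := by
  induction N with
  | zero =>
    have h2 : (2 : ZMod 3) ≠ 0 := by decide
    simp only [wordPrefix, List.mem_cons, List.not_mem_nil, or_false] at ha
    rcases ha with rfl | rfl | rfl
    · exact natDegree_X
    · exact natDegree_linear h2
    · exact natDegree_X_add_C 1
  | succ N ih =>
    rcases List.mem_append.mp ha with h | h
    exacts [ih h, natDegree_of_mem_wordH h]

/-! ### The complete quotients of the root -/

theorem three_eq_zero_invLaurent : (3 : InvLaurent (ZMod 3)) = 0 := by
  have := congrArg ofPoly three_eq_zero
  rwa [map_ofNat, map_zero] at this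

instance : CharP (InvLaurent (ZMod 3)) 3 :=
  charP_of_injective_ringHom (f := (ofPoly (k := ZMod 3)).toRingHom) ofPoly_injective 3

theorem cfEval_map_pow (w : List (ZMod 3)[X]) (z : InvLaurent (ZMod 3)) :
    cfEval (w.map (· ^ 3)) (z ^ 3) = cfEval w z ^ 3 := by
  induction w with
  | nil => rfl
  | cons a w ih => rw [List.map_cons, cfEval_cons, cfEval_cons, ih, add_pow_char, inv_pow, map_pow]

/-- The homography with matrix `shiftMat X`, applied to the cube of `z`. -/
def cubeShift (z : InvLaurent (ZMod 3)) : InvLaurent (ZMod 3) :=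
  ((indet _ ^ 3 - indet _) * z ^ 3 + 1) / ((indet _ ^ 2 + 1) * z ^ 3)

theorem absv_indet {k : Type*} [Field k] : absv (indet k) = 2 := by
  rw [← ofPoly_X, absv_ofPoly X_ne_zero, natDegree_X, pow_one]

theorem absv_indet_sq_add_one {k : Type*} [Field k] : absv (indet k ^ 2 + 1) = 4 := by
  rw [absv_add_eq_left] <;> norm_num [absv_pow, absv_indet, absv_one]

theorem absv_cubeShift {z : InvLaurent (ZMod 3)} (hz : absv z = 2) : absv (cubeShift z) = 2 := by
  have h1 : absv (indet (ZMod 3) ^ 3 - indet _) = 8 := by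
    rw [absv_sub_eq_left] <;> norm_num [absv_pow, absv_indet]
  rw [cubeShift, absv_div, absv_mul, absv_indet_sq_add_one, absv_add_eq_left] <;>
    norm_num [absv_mul, absv_pow, h1, hz, absv_one]

/-- A matrix identity gives the expansion of the image of a cube under a homography. -/
theorem mul_cfEval_cubeShift {w w' : List (ZMod 3)[X]} (hw : ∀ a ∈ w, 0 < a.natDegree)
    (hw' : ∀ a ∈ w', 0 < a.natDegree) {U : Matrix (Fin 2) (Fin 2) (ZMod 3)[X]}
    (h : U * cfMat (w.map (· ^ 3)) = cfMat w' * shiftMat X) {z : InvLaurent (ZMod 3)}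
    (hz : absv z = 2) :
    (ofPoly (U 1 0) * cfEval w z ^ 3 + ofPoly (U 1 1)) * cfEval w' (cubeShift z) =
      ofPoly (U 0 0) * cfEval w z ^ 3 + ofPoly (U 0 1) := by
  have hz0 : z ≠ 0 := ne_zero_of_absv_pos (by rw [hz]; norm_num)
  have hz3 : 1 < absv (z ^ 3) := by rw [absv_pow, hz]; norm_num
  have hx0 : indet (ZMod 3) ^ 2 + 1 ≠ 0 :=
    ne_zero_of_absv_pos (by rw [absv_indet_sq_add_one]; norm_num)
  have hw3 : ∀ a ∈ w.map (· ^ 3), 0 < a.natDegree := by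
    intro a ha
    obtain ⟨b, hb, rfl⟩ := List.mem_map.mp ha
    rw [natDegree_pow]
    exact Nat.mul_pos three_pos (hw b hb)
  obtain ⟨l, hl, h0, h1⟩ := cfMat_mul_eq hw3 hz3
  obtain ⟨m, hm, h0', h1'⟩ := cfMat_mul_eq hw' (z := cubeShift z)
    (by rw [absv_cubeShift hz]; norm_num)
  have hl0 : l ≠ 0 := ne_zero_of_absv_pos (lt_of_lt_of_le (by positivity) hl)
  rw [cfEval_map_pow] at h0
  set M := cfMat (w.map (· ^ 3))
  set M' := cfMat w'
  set d := (indet (ZMod 3) ^ 2 + 1) * z ^ 3 with hd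
  have hs : d * cubeShift z = (indet _ ^ 3 - indet _) * z ^ 3 + 1 :=
    mul_div_cancel₀ _ (mul_ne_zero hx0 (pow_ne_zero 3 hz0))
  have hent : ∀ i, (ofPoly (U i 0) * cfEval w z ^ 3 + ofPoly (U i 1)) * l =
      d * (ofPoly (M' i 0) * cubeShift z + ofPoly (M' i 1)) := by
    intro i
    have e0 := congrArg ofPoly (congrFun (congrFun h i) 0)
    have e1 := congrArg ofPoly (congrFun (congrFun h i) 1)
    simp only [Matrix.mul_apply, Fin.sum_univ_two, shiftMat, Matrix.of_apply, Matrix.cons_val_zero,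
      Matrix.cons_val_one, map_add, map_mul, map_sub, map_pow, map_one, ofPoly_X,
      mul_one, mul_zero, add_zero] at e0 e1
    linear_combination z ^ 3 * e0 + e1 - ofPoly (U i 0) * h0 - ofPoly (U i 1) * h1 -
      ofPoly (M' i 0) * hs
  refine mul_right_cancel₀ hl0 ?_
  rw [hent 0, mul_right_comm, hent 1, h0', h1']
  ring

/-! ### The quartic equation -/

theorem quarticEval_eq (Z : InvLaurent (ZMod 3)) : quarticEval Z =
    indet _ * (indet _ + 2) * Z ^ 4 -
      (indet _ ^ 3 + 2 * indet _ ^ 2 + 2 * indet _ + 2) * Z ^ 3 + Z - indet _ - 1 := by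
  simp only [quarticEval, map_mul, map_add, map_pow, ofPoly_X, map_ofNat]

theorem absv_quartic_coeff_four : absv (indet (ZMod 3) * (indet _ + 2)) = 4 := by
  have h2 : absv (2 : InvLaurent (ZMod 3)) = 1 := by
    have : (2 : InvLaurent (ZMod 3)) = -1 := by linear_combination three_eq_zero_invLaurent
    rw [this, absv_neg, absv_one]
  rw [absv_mul, absv_add_eq_left] <;> norm_num [absv_indet, h2]

theorem absv_quartic_coeff_three :
    absv (indet (ZMod 3) ^ 3 + 2 * indet _ ^ 2 + 2 * indet _ + 2) = 8 := by
  have : indet (ZMod 3) ^ 3 + 2 * indet _ ^ 2 + 2 * indet _ + 2 =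
      ofPoly (X ^ 3 + 2 * X ^ 2 + 2 * X + 2) := by
    simp only [map_mul, map_add, map_pow, ofPoly_X, map_ofNat]
  have hd : (X ^ 3 + 2 * X ^ 2 + 2 * X + 2 : (ZMod 3)[X]).natDegree = 3 := by
    compute_degree!
  rw [this, absv_ofPoly (by rintro h0; rw [h0, natDegree_zero] at hd; omega), hd]
  norm_num

theorem absv_indet_add_one {k : Type*} [Field k] : absv (indet k + 1) = 2 := by
  rw [absv_add_eq_left] <;> norm_num [absv_indet, absv_one]

theorem absv_le_one_of_lt_two {k : Type*} [Field k] {F : InvLaurent k} (h : absv F < 2) :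
    absv F ≤ 1 := by
  by_contra hc
  exact absurd (two_le_absv (not_le.mp hc)) (not_le.mpr h)

theorem absv_le_half_of_lt_one {k : Type*} [Field k] {F : InvLaurent k} (h : absv F < 1) :
    absv F ≤ 1 / 2 := by
  by_cases hF : F = 0
  · rw [hF, absv_zero]; norm_num
  have h0 := absv_pos hF
  have h2 : 2 ≤ absv F⁻¹ := two_le_absv (by rw [absv_inv]; exact (one_lt_inv₀ h0).mpr h)
  rw [absv_inv] at h2
  rw [one_div]
  exact (le_inv_comm₀ (by norm_num) h0).mp h2

/-- A Newton polygon argument on the sizes `4t⁴`, `8t³`, `t`, `2`. The only other slope, `t³ = 1/4`,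
is no power of `2`; hence the appeal to the gaps of the value group between `1/2`, `1` and `2`. -/
theorem absv_quartic_root {Z : InvLaurent (ZMod 3)} (h : quarticEval Z = 0) : absv Z = 2 := by
  rw [quarticEval_eq] at h
  have hA := absv_quartic_coeff_four
  have hB := absv_quartic_coeff_three
  have hC := absv_indet_add_one (k := ZMod 3)
  set A := indet (ZMod 3) * (indet _ + 2)
  set B := indet (ZMod 3) ^ 3 + 2 * indet _ ^ 2 + 2 * indet _ + 2
  set C := indet (ZMod 3) + 1 with hCdef
  have ha : absv (A * Z ^ 4) = 4 * absv Z ^ 4 := by rw [absv_mul, absv_pow, hA]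
  have hb : absv (B * Z ^ 3) = 8 * absv Z ^ 3 := by rw [absv_mul, absv_pow, hB]
  have ht := absv_nonneg Z
  set t := absv Z with htdef
  rcases lt_trichotomy t 2 with hlt | heq | hgt
  · exfalso
    have hle : t ≤ 1 := absv_le_one_of_lt_two hlt
    rcases hle.eq_or_lt with h1 | h1
    · have hr : B * Z ^ 3 = A * Z ^ 4 + (Z - C) := by
        rw [hCdef]; linear_combination -h
      have := absv_add_le (A * Z ^ 4) (Z - C)
      rw [← hr, absv_sub_eq_right (by rw [← htdef, h1, hC]; norm_num), ha, hb, hC, h1] at this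
      norm_num at this
    · have h2 := absv_le_half_of_lt_one h1
      rw [← htdef] at h2
      have hr : C = A * Z ^ 4 + (Z - B * Z ^ 3) := by
        rw [hCdef]; linear_combination -h
      have h3 : absv (Z - B * Z ^ 3) ≤ 1 := by
        rw [sub_eq_add_neg]
        refine (absv_add_le _ _).trans (max_le (by linarith) ?_)
        rw [absv_neg, hb]
        have := pow_le_pow_left₀ ht h2 3
        norm_num at this
        linarith
      have h4 : absv (A * Z ^ 4) ≤ 1 := by
        rw [ha]
        have := pow_le_pow_left₀ ht h2 4
        norm_num at this
        linarith
      have := absv_add_le (A * Z ^ 4) (Z - B * Z ^ 3)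
      rw [← hr, hC] at this
      linarith [max_le h4 h3]
  · exact heq
  · exfalso
    have hr : A * Z ^ 4 = B * Z ^ 3 - (Z - C) := by
      rw [hCdef]; linear_combination h
    have h3 : 8 < t ^ 3 := by
      have := pow_lt_pow_left₀ hgt (by norm_num) three_ne_zero
      norm_num at this
      exact this
    have h4 : t ^ 4 = t ^ 3 * t := pow_succ t 3
    have h5 : absv (Z - C) = t := by rw [absv_sub_eq_left (by rw [hC]; exact hgt)]
    have h6 : t < 8 * t ^ 3 := by nlinarith [pow_pos (by linarith : 0 < t) 2]
    have := congrArg absv hr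
    rw [absv_sub_eq_left (by rw [h5, hb]; exact h6), ha, hb, h4] at this
    nlinarith

theorem absv_mul_cube_add_one {Z : InvLaurent (ZMod 3)} (h : absv Z = 2) :
    absv (indet _ * (indet _ + 2) * Z ^ 3 + 1) = 32 := by
  rw [absv_add_eq_left] <;>
    norm_num [absv_mul _ (Z ^ 3), absv_pow, absv_quartic_coeff_four, h, absv_one]

/-- Applying the homography to `Z³` and `W³` multiplies their difference `(Z - W)³` by the
determinant over the product of denominators. Cancelling `Z - W` would force `|Z - W| = 16`,
although both roots have absolute value `2`. -/
theorem quartic_root_unique {Z W : InvLaurent (ZMod 3)} (hZ : quarticEval Z = 0)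
    (hW : quarticEval W = 0) : Z = W := by
  have hZ2 := absv_quartic_root hZ
  have hW2 := absv_quartic_root hW
  rw [quarticEval_eq] at hZ hW
  have h3 := three_eq_zero_invLaurent
  set x := indet (ZMod 3) with hx
  by_contra hne
  have hsub : Z - W ≠ 0 := sub_ne_zero.mpr hne
  have key : (x * (x + 2) * Z ^ 3 + 1) * (x * (x + 2) * W ^ 3 + 1) =
      -((x ^ 2 + 1) * (Z - W) ^ 2) := by
    refine mul_right_cancel₀ hsub ?_
    have hfrob : (Z - W) ^ 3 = Z ^ 3 - W ^ 3 := sub_pow_char Z W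
    linear_combination (x * (x + 2) * W ^ 3 + 1) * hZ - (x * (x + 2) * Z ^ 3 + 1) * hW +
      (x ^ 2 + 1) * hfrob + (Z ^ 3 - W ^ 3) * h3
  have h1 := congrArg absv key
  rw [absv_mul, absv_mul_cube_add_one hZ2, absv_mul_cube_add_one hW2, absv_neg, absv_mul, absv_pow,
    hx, absv_indet_sq_add_one] at h1
  have h2 : absv (Z - W) ≤ 2 := by
    rw [sub_eq_add_neg]
    refine (absv_add_le _ _).trans (max_le hZ2.le ?_)
    rw [absv_neg, hW2]
  nlinarith [absv_nonneg (Z - W)]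

theorem exists_quartic_root : ∃ Z : InvLaurent (ZMod 3), quarticEval Z = 0 := by
  let T : PowerSeries (ZMod 3) := PowerSeries.X
  have h3 : (3 : PowerSeries (ZMod 3)) = 0 := by
    have := congrArg (PowerSeries.C (R := ZMod 3)) (show (3 : ZMod 3) = 0 by decide)
    rwa [map_ofNat, map_zero] at this
  obtain ⟨v, hv⟩ : ∃ v, v * (1 + 2 * T) = 1 := by
    refine ⟨(1 + 2 * T)⁻¹, PowerSeries.inv_mul_cancel _ ?_⟩
    simp [T]
  have : HenselianRing (PowerSeries (ZMod 3)) (Ideal.span {PowerSeries.X}) := inferInstance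
  let b := v * (1 + 2 * T + 2 * T ^ 2 + 2 * T ^ 3)
  -- The quartic in `Y = Z / X`, divided by `X⁶` and made monic. Modulo `T` it is `Y⁴ - Y³`, with
  -- simple root `1`, so Hensel's lemma applies.
  let f : (PowerSeries (ZMod 3))[X] :=
    X ^ 4 - C b * X ^ 3 + C (v * T ^ 5) * X - C (v * (T ^ 5 + T ^ 6))
  have hf : f.Monic := by
    have hdeg : f.natDegree = 4 := by
      simp only [f]; compute_degree!
    rw [Monic, leadingCoeff, hdeg]
    simp only [f]
    compute_degree!
  have hev : ∀ Y, f.eval Y = Y ^ 4 - b * Y ^ 3 + v * T ^ 5 * Y - v * (T ^ 5 + T ^ 6) := by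
    intro Y; simp [f]
  have hTmem : ∀ a, a * T ∈ Ideal.span {(PowerSeries.X : PowerSeries (ZMod 3))} := fun a =>
    Ideal.mul_mem_left _ _ (Ideal.mem_span_singleton_self _)
  obtain ⟨Y, hY, -⟩ := HenselianRing.is_henselian (I := Ideal.span {PowerSeries.X}) f hf 1
    (by
      have : f.eval 1 = (-v * (2 * T + 2 * T ^ 2 + T ^ 5)) * T := by
        rw [hev]; simp only [b]; linear_combination -hv
      rw [this]
      exact hTmem _)
    (by
      have : f.derivative.eval 1 = 1 + v * T ^ 4 * T := by
        simp [f, -map_mul, -map_add, -map_pow]; linear_combination (1 - b) * h3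
      rw [this, map_add, map_one, Ideal.Quotient.eq_zero_iff_mem.mpr (hTmem _), add_zero]
      exact isUnit_one)
  have hroot : (1 + 2 * T) * Y ^ 4 - (1 + 2 * T + 2 * T ^ 2 + 2 * T ^ 3) * Y ^ 3 + T ^ 5 * Y -
      (T ^ 5 + T ^ 6) = 0 := by
    have : Y ^ 4 - b * Y ^ 3 + v * T ^ 5 * Y - v * (T ^ 5 + T ^ 6) = 0 := by rw [← hev]; exact hY
    simp only [b] at this
    linear_combination (1 + 2 * T) * this - (-(1 + 2 * T + 2 * T ^ 2 + 2 * T ^ 3) * Y ^ 3 + T ^ 5 * Y -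
      (T ^ 5 + T ^ 6)) * hv
  have himg := congrArg (HahnSeries.ofPowerSeries ℤ (ZMod 3)) hroot
  simp only [map_add, map_sub, map_mul, map_pow, map_one, map_zero, map_ofNat, T,
    HahnSeries.ofPowerSeries_X] at himg
  have hx : indet (ZMod 3) * HahnSeries.single 1 1 = 1 := by
    rw [indet, HahnSeries.single_mul_single]
    simp
  set x := indet (ZMod 3)
  set s : InvLaurent (ZMod 3) := HahnSeries.single 1 1
  set y := HahnSeries.ofPowerSeries ℤ (ZMod 3) Y
  refine ⟨x * y, ?_⟩
  have hs : s = x⁻¹ := eq_inv_of_mul_eq_one_right hx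
  have hx0 : x ≠ 0 := left_ne_zero_of_mul_eq_one hx
  rw [quarticEval_eq]
  rw [hs] at himg
  field_simp at himg
  linear_combination himg

/-! ### The expansion of the root -/

/-- The complete quotients `[Hₙ₊₁, Hₙ₊₂, …]` of the root `Θ` of the quartic. -/
def blockTail (Θ : InvLaurent (ZMod 3)) : ℕ → InvLaurent (ZMod 3)
  | 0 => (Θ ^ 3 + (2 * indet _ + 1)) / (indet _ ^ 2 + 1)
  | n + 1 => cubeShift (blockTail Θ n)

theorem absv_blockTail {Θ : InvLaurent (ZMod 3)} (hΘ : quarticEval Θ = 0) (n : ℕ) :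
    absv (blockTail Θ n) = 2 := by
  induction n with
  | zero =>
    have h1 : absv (2 * indet (ZMod 3) + 1) = 2 := by
      have : 2 * indet (ZMod 3) + 1 = -(indet _ - 1) := by
        linear_combination indet _ * three_eq_zero_invLaurent
      rw [this, absv_neg, absv_sub_eq_left] <;> norm_num [absv_indet, absv_one]
    rw [blockTail, absv_div, absv_indet_sq_add_one, absv_add_eq_left] <;>
      norm_num [absv_pow, absv_quartic_root hΘ, h1]
  | succ n ih => exact absv_cubeShift ih

theorem one_lt_absv_blockTail {Θ : InvLaurent (ZMod 3)} (hΘ : quarticEval Θ = 0) (n : ℕ) :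
    1 < absv (blockTail Θ n) := by
  rw [absv_blockTail hΘ]; norm_num

theorem natDegree_pos_of_mem_wordH {n : ℕ} (a : (ZMod 3)[X]) (ha : a ∈ wordH n) :
    0 < a.natDegree := by
  rw [natDegree_of_mem_wordH ha]; exact one_pos

theorem natDegree_pos_of_mem_wordPrefix {n : ℕ} (a : (ZMod 3)[X]) (ha : a ∈ wordPrefix n) :
    0 < a.natDegree := by
  rw [natDegree_of_mem_wordPrefix ha]; exact one_pos

/-- Once denominators are cleared, this is the quartic equation itself, modulo `3`. -/
theorem cfEval_wordPrefix_zero {Θ : InvLaurent (ZMod 3)} (hΘ : quarticEval Θ = 0) :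
    cfEval (wordPrefix 0) (blockTail Θ 0) = Θ := by
  have h3 := three_eq_zero_invLaurent
  have hx0 : indet (ZMod 3) ^ 2 + 1 ≠ 0 :=
    ne_zero_of_absv_pos (by rw [absv_indet_sq_add_one]; norm_num)
  have hden : indet (ZMod 3) * (indet _ + 2) * Θ ^ 3 + 1 ≠ 0 :=
    ne_zero_of_absv_pos (by rw [absv_mul_cube_add_one (absv_quartic_root hΘ)]; norm_num)
  obtain ⟨l, hl, h0, h1⟩ := cfMat_mul_eq (natDegree_pos_of_mem_wordPrefix (n := 0))
    (one_lt_absv_blockTail hΘ 0)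
  have ht : (indet (ZMod 3) ^ 2 + 1) * blockTail Θ 0 = Θ ^ 3 + (2 * indet _ + 1) :=
    mul_div_cancel₀ _ hx0
  set c := cfEval (wordPrefix 0) (blockTail Θ 0)
  set z := blockTail Θ 0
  set x := indet (ZMod 3) with hx
  rw [← h1] at h0
  simp [wordPrefix, ofPoly_X, ← hx] at h0
  rw [quarticEval_eq, ← hx] at hΘ
  have h2 : ofPoly (2 : (ZMod 3)[X]) = 2 := map_ofNat _ 2
  rw [h2] at h0
  refine mul_left_cancel₀ hden ?_
  linear_combination (x ^ 2 + 1) * h0 - (x * ((2 * x + 2) * (x + 1) + 1) + (x + 1)) * ht +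
    ((2 * x + 2) * (x + 1) + 1) * c * ht - hΘ +
    ((x ^ 2 + 2 * x + 1) * Θ ^ 3 * c + (2 * x ^ 3 + 4 * x ^ 2 + 4 * x + 2) * c -
      (x ^ 3 + 2 * x ^ 2 + 2 * x + 1) * Θ ^ 3 -
      (2 * x ^ 4 + 4 * x ^ 3 + 5 * x ^ 2 + 3 * x + 1)) * h3

/-- Each tail is a homography of the cube of the previous one (of `Θ` at the start). Cubing the
expansion already known for the latter and applying the matrix identity produces the next block. -/
theorem blockTail_eq {Θ : InvLaurent (ZMod 3)} (hΘ : quarticEval Θ = 0) (n : ℕ) :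
    blockTail Θ n = cfEval (wordH (n + 1)) (blockTail Θ (n + 1)) := by
  induction n with
  | zero =>
    have hx0 : indet (ZMod 3) ^ 2 + 1 ≠ 0 :=
      ne_zero_of_absv_pos (by rw [absv_indet_sq_add_one]; norm_num)
    have := mul_cfEval_cubeShift natDegree_pos_of_mem_wordPrefix natDegree_pos_of_mem_wordH
      mul_wordPrefix_zero (absv_blockTail hΘ 0)
    rw [cfEval_wordPrefix_zero hΘ] at this
    simp only [Matrix.of_apply, Matrix.cons_val_zero, Matrix.cons_val_one, map_add, map_mul, map_pow,
      map_one, map_zero, ofPoly_X, zero_mul, zero_add, one_mul, map_ofNat] at this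
    rw [blockTail, div_eq_iff hx0, blockTail, mul_comm (cfEval _ _)]
    exact this.symm
  | succ n ih =>
    have := mul_cfEval_cubeShift natDegree_pos_of_mem_wordH natDegree_pos_of_mem_wordH
      (shiftMat_mul_wordH (Nat.le_add_left 1 n)) (absv_blockTail hΘ (n + 1))
    have h0 : blockTail Θ n ≠ 0 := ne_zero_of_absv_pos (by rw [absv_blockTail hΘ]; norm_num)
    have hx0 : indet (ZMod 3) ^ 2 + 1 ≠ 0 :=
      ne_zero_of_absv_pos (by rw [absv_indet_sq_add_one]; norm_num)
    rw [← ih] at this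
    simp only [shiftMat, Matrix.of_apply, Matrix.cons_val_zero, Matrix.cons_val_one, map_add, map_sub,
      map_pow, map_one, map_zero, ofPoly_X, add_zero] at this
    rw [blockTail, cubeShift, div_eq_iff (mul_ne_zero hx0 (pow_ne_zero 3 h0)),
      mul_comm (cfEval _ _)]
    exact this.symm

theorem cfEval_wordPrefix {Θ : InvLaurent (ZMod 3)} (hΘ : quarticEval Θ = 0) (N : ℕ) :
    cfEval (wordPrefix N) (blockTail Θ N) = Θ := by
  induction N with
  | zero => exact cfEval_wordPrefix_zero hΘ
  | succ N ih => rw [wordPrefix, cfEval_append, ← blockTail_eq hΘ, ih]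

theorem hasContFrac_millsRobbins {Θ : InvLaurent (ZMod 3)} (hΘ : quarticEval Θ = 0) :
    HasContFrac Θ millsRobbins :=
  hasContFrac_of_prefixes fun n => ⟨wordPrefix n, blockTail Θ n, lt_length_wordPrefix n,
    natDegree_pos_of_mem_wordPrefix, one_lt_absv_blockTail hΘ n, (cfEval_wordPrefix hΘ n).symm, rfl⟩

theorem badWith_of_quartic_root {Θ : InvLaurent (ZMod 3)} (hΘ : quarticEval Θ = 0) :
    BadWith ((2 : ℝ) ^ 1)⁻¹ Θ :=
  (hasContFrac_millsRobbins hΘ).badWith fun _ =>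
    (natDegree_of_mem_wordPrefix (List.getElem_mem _)).le

theorem littlewood_of_quartic_root {Θ : InvLaurent (ZMod 3)} (hΘ : quarticEval Θ = 0) :
    Littlewood Θ Θ⁻¹ := by
  refine littlewood_of_forall_exists fun ε hε => ?_
  -- With `|A| = a` and `|V| = 3a - 2`, the palindrome bound equals `16 / 2 ^ a`.
  obtain ⟨n, hn⟩ := exists_nat_gt (16 / ε)
  set a := 3 ^ (n + 1) with ha
  have hna : n < a := (Nat.lt_succ_self n).trans (Nat.lt_pow_self (by norm_num))
  have ha3 : 3 ≤ a := by rw [ha, pow_succ]; have := Nat.one_le_pow n 3 three_pos; omega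
  have hlenH : (wordH (n + 1)).length = 2 * a := by
    simp only [wordH, List.length_append, List.length_replicate, List.length_cons, List.length_nil,
      ← ha]
    omega
  have hsplit : List.replicate (3 ^ (n + 2) - 2) (X : (ZMod 3)[X]) =
      List.replicate (a - 2) X ++ List.replicate (2 * a) X := by
    rw [← List.replicate_add]
    congr 1
    rw [pow_succ, ← ha]; omega
  obtain ⟨w, hw⟩ : ∃ w, wordH (n + 2) = List.replicate (a - 2) X ++ w := by
    rw [wordH, hsplit]
    simp only [List.append_assoc]
    exact ⟨_, rfl⟩
  have hw1 : ∀ b ∈ w, b.natDegree = 1 := fun b hb =>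
    natDegree_of_mem_wordH (n := n + 2) (by rw [hw]; exact List.mem_append_right _ hb)
  have hz := absv_cfEval_eq_two hw1 (absv_blockTail hΘ (n + 2))
  -- `Hₙ₊₁` starts with `a - 2` letters `X` and, without them, is a palindrome framed by `X + ε`;
  -- borrowing as many `X` from `Hₙ₊₂` restores the symmetry.
  set V := wordH (n + 1) ++ List.replicate (a - 2) X with hV
  have hVlen : V.length = 3 * a - 2 := by
    rw [hV, List.length_append, hlenH, List.length_replicate]; omega
  have hVrev : V.reverse = V := by
    simp [hV, wordH, ← ha]
  have hV1 : ∀ b ∈ V, b.natDegree = 1 := by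
    intro b hb
    rcases List.mem_append.mp hb with h | h
    · exact natDegree_of_mem_wordH h
    · rw [(List.mem_replicate.mp h).2, natDegree_X]
  have hΘeq : cfEval (wordPrefix n ++ V) (cfEval w (blockTail Θ (n + 2))) = Θ := by
    rw [hV, ← List.append_assoc, cfEval_append, ← cfEval_append _ w, ← hw, ← blockTail_eq hΘ]
    exact cfEval_wordPrefix hΘ (n + 1)
  obtain ⟨q, hq, hle⟩ := exists_approx_of_palindrome (A := wordPrefix n)
    (fun b hb => natDegree_of_mem_wordPrefix hb) hV1 hVrev (by omega) hz
  rw [hΘeq, length_wordPrefix, ← ha, hVlen] at hle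
  refine ⟨q, hq, hle.trans ?_⟩
  have hexp : (2 : ℝ) ^ (2 * a + 2) * 2 ^ a = 16 * 2 ^ (3 * a - 2) := by
    rw [show (16 : ℝ) = 2 ^ 4 by norm_num, ← pow_add, ← pow_add]
    congr 1
    omega
  have hbig : 16 / ε < 2 ^ a := by
    refine hn.trans ?_
    exact_mod_cast hna.trans Nat.lt_two_pow_self
  rw [div_lt_iff₀ hε] at hbig
  rw [div_le_iff₀ (by positivity)]
  have h2a : (0 : ℝ) < 2 ^ a := by positivity
  refine le_of_mul_le_mul_right ?_ h2a
  rw [hexp, mul_right_comm, mul_comm ε]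
  exact mul_le_mul_of_nonneg_right hbig.le (by positivity)

/-! ### Algebraic degree -/

/-- A unique root of a quartic in an extension field is rational or of degree four. -/
theorem natDegree_minpoly_eq_four {K L : Type*} [Field K] [Field L] [Algebra K L]
    (h2 : (2 : K) ≠ 0) {f : K[X]} (hf : f.natDegree = 4) {t : L} (ht : aeval t f = 0)
    (huniq : ∀ s, aeval s f = 0 → s = t) (hirr : t ∉ (algebraMap K L).range) :
    (minpoly K t).natDegree = 4 := by
  have hf0 : f ≠ 0 := by rintro rfl; simp at hf
  have hint : IsIntegral K t := IsAlgebraic.isIntegral ⟨f, hf0, ht⟩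
  obtain ⟨g, hg⟩ := minpoly.dvd K t ht
  have hmonic := minpoly.monic hint
  have hroot := minpoly.aeval K t
  have hg0 : g ≠ 0 := by rintro rfl; exact hf0 (by rw [hg, mul_zero])
  have hdeg : (minpoly K t).natDegree + g.natDegree = 4 := by
    rw [← natDegree_mul hmonic.ne_zero hg0, ← hg, hf]
  have hpos := minpoly.natDegree_pos hint
  have hne1 : (minpoly K t).natDegree ≠ 1 := fun h => hirr (minpoly.natDegree_eq_one_iff.mp h)
  have huniq' : ∀ s, aeval s (minpoly K t) = 0 ∨ aeval s g = 0 → s = t := by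
    intro s hs
    refine huniq s ?_
    rw [hg, map_mul]
    rcases hs with h | h <;> rw [h] <;> simp
  have hne2 : (minpoly K t).natDegree ≠ 2 := by
    intro h
    have hm : minpoly K t = X ^ 2 + C ((minpoly K t).coeff 1) * X + C ((minpoly K t).coeff 0) := by
      have := hmonic.as_sum
      rw [h, Finset.sum_range_succ, Finset.sum_range_one] at this
      rw [this]
      simp
      ring
    set b := (minpoly K t).coeff 1
    set c := (minpoly K t).coeff 0
    -- The conjugate of `t` also lies in `L`, so uniqueness makes `t` a double root, equal to `-b /
    -- 2` in `K`.
    have hother : -algebraMap K L b - t = t := by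
      refine huniq' _ (Or.inl ?_)
      rw [hm] at hroot ⊢
      simp at hroot ⊢
      linear_combination hroot
    refine hirr ⟨-b / 2, ?_⟩
    have h2' : (2 : L) ≠ 0 := by
      rw [← map_ofNat (algebraMap K L) 2]
      exact (_root_.map_ne_zero _).mpr h2
    rw [map_div₀, map_neg, map_ofNat, div_eq_iff h2']
    linear_combination hother
  have hne3 : (minpoly K t).natDegree ≠ 3 := by
    intro h
    -- The complementary linear factor has a root in `K`, which must be `t`.
    have hg1 : g.degree = 1 := by
      rw [degree_eq_natDegree hg0]
      exact_mod_cast (by omega : g.natDegree = 1)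
    obtain ⟨r, hr⟩ := exists_root_of_degree_eq_one hg1
    refine hirr ⟨r, huniq' _ (Or.inr ?_)⟩
    rw [aeval_algebraMap_apply, coe_aeval_eq_eval, hr.eq_zero, map_zero]
  omega

theorem natDegree_minpoly_inv {K L : Type*} [Field K] [Field L] [Algebra K L] {t : L}
    (ht : IsIntegral K t) : (minpoly K t⁻¹).natDegree = (minpoly K t).natDegree := by
  have : IntermediateField.adjoin K {t⁻¹} = IntermediateField.adjoin K {t} := by
    refine le_antisymm (IntermediateField.adjoin_simple_le_iff.mpr ?_)
      (IntermediateField.adjoin_simple_le_iff.mpr ?_)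
    · exact inv_mem (IntermediateField.mem_adjoin_simple_self K t)
    · rw [← inv_inv t]
      exact inv_mem (by rw [inv_inv]; exact IntermediateField.mem_adjoin_simple_self K t⁻¹)
  rw [← IntermediateField.adjoin.finrank ht, ← IntermediateField.adjoin.finrank ht.inv, this]

theorem IsQuartic.inv {k : Type*} [Field k] {Θ : InvLaurent k} (h : IsQuartic Θ) :
    IsQuartic Θ⁻¹ :=
  ⟨h.1.inv, by rw [natDegree_minpoly_inv h.1, h.2]⟩

theorem ofPoly_mem_ratField {k : Type*} [Field k] (p : k[X]) : ofPoly p ∈ ratField k :=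
  IntermediateField.algebra_adjoin_le_adjoin k {indet k} (p.aeval_mem_adjoin_singleton k (indet k))

/-- The embedding `k[X] → k(X)`. -/
def ratOfPoly {k : Type*} [Field k] (p : k[X]) : ratField k := ⟨ofPoly p, ofPoly_mem_ratField p⟩

theorem algebraMap_ratOfPoly {k : Type*} [Field k] (p : k[X]) :
    algebraMap (ratField k) (InvLaurent k) (ratOfPoly p) = ofPoly p := rfl

theorem ratOfPoly_eq_zero {k : Type*} [Field k] {p : k[X]} : ratOfPoly p = 0 ↔ p = 0 := by
  rw [← ofPoly_eq_zero, ← algebraMap_ratOfPoly, map_eq_zero]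

theorem BadWith.notMem_range {k : Type*} [Field k] {c : ℝ} {F : InvLaurent k} (hc : 0 < c)
    (h : BadWith c F) (hF : F ≠ 0) : F ∉ (algebraMap (ratField k) (InvLaurent k)).range := by
  rintro ⟨⟨y, hy⟩, rfl⟩
  obtain ⟨r, s, hrs⟩ := (IntermediateField.mem_adjoin_simple_iff k y).mp hy
  have hrs' : y = ofPoly r / ofPoly s := hrs
  change BadWith c y at h
  change y ≠ 0 at hF
  have hs : ofPoly s ≠ 0 := by
    intro h0
    rw [h0, div_zero] at hrs'
    exact hF hrs'
  refine h.ofPoly_mul_ne hc (ofPoly_eq_zero.not.mp hs) r ?_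
  rw [hrs', mul_div_cancel₀ _ hs]

theorem IsQuartic.linIndepWithOne_inv {k : Type*} [Field k] {Θ : InvLaurent k}
    (h : IsQuartic Θ) (h0 : Θ ≠ 0) : LinIndepWithOne Θ Θ⁻¹ := by
  intro a b c habc
  set p : (ratField k)[X] := C (ratOfPoly b) * X ^ 2 + C (ratOfPoly a) * X + C (ratOfPoly c)
    with hp
  have haev : aeval Θ p = 0 := by
    simp only [hp, map_add, map_mul, map_pow, aeval_X, aeval_C, algebraMap_ratOfPoly]
    field_simp at habc
    linear_combination habc
  have hp0 : p = 0 := by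
    by_contra hne
    have h1 := minpoly.degree_le_of_ne_zero (ratField k) Θ hne haev
    have h2 : (minpoly (ratField k) Θ).natDegree ≤ p.natDegree := natDegree_le_natDegree h1
    have h3 : p.natDegree ≤ 2 := natDegree_quadratic_le
    have h4 := h.2
    omega
  refine ⟨?_, ?_, ?_⟩ <;> rw [← ratOfPoly_eq_zero]
  · simpa [hp, coeff_X, coeff_C] using congrArg (fun f => f.coeff 1) hp0
  · simpa [hp, coeff_X, coeff_C] using congrArg (fun f => f.coeff 2) hp0
  · simpa [hp, coeff_X, coeff_C] using congrArg (fun f => f.coeff 0) hp0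

theorem isQuartic_of_quartic_root {Θ : InvLaurent (ZMod 3)} (hΘ : quarticEval Θ = 0) :
    IsQuartic Θ := by
  have h0 : Θ ≠ 0 := ne_zero_of_absv_pos (by rw [absv_quartic_root hΘ]; norm_num)
  let f : (ratField (ZMod 3))[X] := C (ratOfPoly (X * (X + 2))) * X ^ 4 -
    C (ratOfPoly (X ^ 3 + 2 * X ^ 2 + 2 * X + 2)) * X ^ 3 + X - C (ratOfPoly (X + 1))
  have hev : ∀ Z, aeval Z f = quarticEval Z := by
    intro Z
    simp only [f, quarticEval, map_sub, map_add, map_mul, map_pow, aeval_X, aeval_C,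
      algebraMap_ratOfPoly, map_ofNat, map_one]
    ring
  have hlead : ratOfPoly (X * (X + 2) : (ZMod 3)[X]) ≠ 0 := by
    rw [Ne, ratOfPoly_eq_zero]
    exact mul_ne_zero X_ne_zero (X_add_C_ne_zero 2)
  have hdeg : f.natDegree = 4 := by
    simp only [f]
    compute_degree!
  have hf0 : f ≠ 0 := by intro hf; rw [hf] at hdeg; simp at hdeg
  refine ⟨IsAlgebraic.isIntegral ⟨f, hf0, by rw [hev, hΘ]⟩, ?_⟩
  refine natDegree_minpoly_eq_four ?_ hdeg (by rw [hev, hΘ])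
    (fun s hs => quartic_root_unique (by rw [← hev, hs]) hΘ)
    ((badWith_of_quartic_root hΘ).notMem_range (by norm_num) h0)
  intro h2
  have h2' : (2 : InvLaurent (ZMod 3)) = 0 := by
    have := congrArg (algebraMap (ratField (ZMod 3)) (InvLaurent (ZMod 3))) h2
    rwa [map_ofNat, map_zero] at this
  exact one_ne_zero (α := InvLaurent (ZMod 3)) (by linear_combination three_eq_zero_invLaurent - h2')

theorem littlewoodNontrivially_of_quartic_root {Θ : InvLaurent (ZMod 3)} (hΘ : quarticEval Θ = 0) :
    LittlewoodNontrivially Θ Θ⁻¹ := by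
  have h0 : Θ ≠ 0 := ne_zero_of_absv_pos (by rw [absv_quartic_root hΘ]; norm_num)
  have hbad := badWith_of_quartic_root hΘ
  refine ⟨littlewood_of_quartic_root hΘ, hbad.mem_bad (by norm_num), (hbad.inv h0).mem_bad ?_,
    (isQuartic_of_quartic_root hΘ).linIndepWithOne_inv h0⟩
  rw [absv_quartic_root hΘ]
  norm_num

end PowerSeriesLittlewood
end

theorem theorem5 :
    (∃! Θ : PowerSeriesLittlewood.InvLaurent (ZMod 3),
      PowerSeriesLittlewood.quarticEval Θ = 0) ∧
    (∀ Θ : PowerSeriesLittlewood.InvLaurent (ZMod 3),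
      PowerSeriesLittlewood.quarticEval Θ = 0 →
        PowerSeriesLittlewood.HasContFrac Θ PowerSeriesLittlewood.millsRobbins ∧
        PowerSeriesLittlewood.IsQuartic Θ ∧
        PowerSeriesLittlewood.IsQuartic Θ⁻¹ ∧
        PowerSeriesLittlewood.LittlewoodNontrivially Θ Θ⁻¹) ∧
    (∃ Θ Φ : PowerSeriesLittlewood.InvLaurent (ZMod 3),
      PowerSeriesLittlewood.IsQuartic Θ ∧ PowerSeriesLittlewood.IsQuartic Φ ∧
        PowerSeriesLittlewood.LittlewoodNontrivially Θ Φ) := by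
  obtain ⟨Θ, hΘ⟩ := PowerSeriesLittlewood.exists_quartic_root
  have hq := PowerSeriesLittlewood.isQuartic_of_quartic_root hΘ
  exact ⟨⟨Θ, hΘ, fun _ h => PowerSeriesLittlewood.quartic_root_unique h hΘ⟩,
    fun Z hZ => ⟨PowerSeriesLittlewood.hasContFrac_millsRobbins hZ,
      PowerSeriesLittlewood.isQuartic_of_quartic_root hZ,
      (PowerSeriesLittlewood.isQuartic_of_quartic_root hZ).inv,
      PowerSeriesLittlewood.littlewoodNontrivially_of_quartic_root hZ⟩,
    ⟨Θ, Θ⁻¹, hq, hq.inv, PowerSeriesLittlewood.littlewoodNontrivially_of_quartic_root hΘ⟩⟩
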